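/- Let $\mathcal{G}$ be a causal graph on a finite set $\mathbf{V}$ of observed variables, i.e. a graph with directed edges $\to$ that form no directed cycle and bidirected edges $\leftrightarrow$ between distinct variables (both kinds may join the same pair). For $\mathbf{X}\subseteq\mathbf{V}$ let $Pa(\mathbf{X})$, $An(\mathbf{X})$, $De(\mathbf{X})$ be the sets of parents, ancestors and descendants of $\mathbf{X}$, each including $\mathbf{X}$ itself, let $pa(\mathbf{X})=\{V : V\to X \text{ for some } X\in\mathbf{X}\}$ and $Sp(\mathbf{X})=\{Y : Y\leftrightarrow X \text{ for some } X\in\mathbf{X}\}$. A set $\mathbf{S}$ is ancestral if $\mathbf{S}=An(\mathbf{S})$. For $X\in\mathbf{S}\subseteq\mathbf{V}$ let $\mathcal{C}(X)_{\mathcal{G}_{\mathbf{S}}}$ be the c-component (district) of $X$ in the induced subgraph $\mathcal{G}_{\mathbf{S}}$: the set of variables joined to $X$ by a path of bidirected edges inside $\mathbf{S}$, including $X$. Let $\mathbf{V}^{\prec}$ be a strict total ordering of $\mathbf{V}$ that is consistent with $\mathcal{G}$ ($X\prec Y$ implies $Y\notin An(\{X\})$), and put $\mathbf{V}^{\le X}=\{Y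 : Y\prec X\text{ or }Y=X\}$. Let $P$ be a probability distribution over $\mathbf{V}$, where each variable takes values in a standard Borel space (e.g. a countable set or $\mathbb{R}$). * $P$ satisfies the *ordered local Markov property* (Richardson 2003) for $\mathcal{G}$ with respect to $\mathbf{V}^{\prec}$ if for every $X\in\mathbf{V}$ and every ancestral set $\mathbf{A}$ with $X\in\mathbf{A}\subseteq\mathbf{V}^{\le X}$, $$X \perp\!\!\!\perp \mathbf{A}\setminus(\mathrm{mb}(X,\mathbf{A})\cup\{X\}) \mid \mathrm{mb}(X,\mathbf{A}) \quad\text{in } P,$$ where $\mathrm{mb}(X,\mathbf{A}) = pa(\mathbf{D})\cup(\mathbf{D}\setminus\{X\})$ with $\mathbf{D}=\mathcal{C}(X)_{\mathcal{G}_{\mathbf{A}}}$. * $P$ satisfies the *c-component local Markov property* (C-LMP) for $\mathcal{G}$ with respect to $\mathbf{V}^{\prec}$ if for every $X\in\mathbf{V}$ and every ancestral c-component $\mathbf{C}$ relative to $X$, i.e. every set of the form $\mathbf{C}=\mathcal{C}(X)_{\mathcal{G}_{\mathbf{S}}}$ for some ancestral set $\mathbf{S}$ with $X\in\mathbf{S}\subseteq\mathbf{V}^{\le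 X}$, $$X \perp\!\!\!\perp \mathbf{S}^+\setminus Pa(\mathbf{C}) \mid Pa(\mathbf{C})\setminus\{X\} \quad\text{in } P, \qquad \mathbf{S}^+=\mathbf{V}^{\le X}\setminus De\big(Sp(\mathbf{C})\setminus Pa(\mathbf{C})\big).$$ Then $P$ satisfies the ordered local Markov property for $\mathcal{G}$ with respect to $\mathbf{V}^{\prec}$ if and only if it satisfies the c-component local Markov property for $\mathcal{G}$ with respect to $\mathbf{V}^{\prec}$. -/

import Mathlib

open MeasureTheory ProbabilityTheory

/-- A (semi-Markovian) causal graph on the observed variables `V`: directed edges, which form no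
directed cycle, and bidirected edges. A pair of variables may be joined by both kinds of edge. -/
structure CausalGraph (V : Type*) where
  /-- `directed.Adj X Y` means that `X → Y` is an edge. -/
  directed : Digraph V
  /-- `bidirected.Adj X Y` means that `X ↔ Y` is an edge. -/
  bidirected : SimpleGraph V
  acyclic : ∀ v, ¬ Relation.TransGen directed.Adj v v

namespace CausalGraph

section Graph

variable {V : Type*} (G : CausalGraph V)

/-- The parents of `A`, including `A` itself. -/
def Pa (A : Set V) : Set V := A ∪ {v | ∃ a ∈ A, G.directed.Adj v a}

/-- The ancestors of `A`, including `A` itself. -/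
def An (A : Set V) : Set V := {v | ∃ a ∈ A, Relation.ReflTransGen G.directed.Adj v a}

/-- The descendants of `A`, including `A` itself. -/
def De (A : Set V) : Set V := {v | ∃ a ∈ A, Relation.ReflTransGen G.directed.Adj a v}

/-- The spouses of `A`: all variables that have a bidirected edge to some element of `A`. -/
def Spo (A : Set V) : Set V := {v | ∃ a ∈ A, G.bidirected.Adj v a}

/-- `A` is an ancestral set if it contains its own ancestors. -/
def IsAncestral (A : Set V) : Prop := A = G.An A

/-- The induced subgraph of `G` on `S`. -/
def induce (S : Set V) : CausalGraph S where
  directed := { Adj := fun a b => G.directed.Adj a b }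
  bidirected := G.bidirected.induce S
  acyclic := fun v h => G.acyclic v (Relation.TransGen.lift Subtype.val (fun _ _ hab => hab) _ _ h)

/-- The c-component (district) of `X` in `G`: the variables joined to `X` by a path of bidirected
edges, `X` included. -/
def cComponent (X : V) : Set V := (G.bidirected.connectedComponentMk X).supp

/-- The c-component of `X` in the induced subgraph of `G` on `S`, as a set of variables of `G`. -/
def cComponentIn (S : Set V) (X : V) (hX : X ∈ S) : Set V :=
  Subtype.val '' (G.induce S).cComponent ⟨X, hX⟩

/-- `prec` is a (strict, total) ordering of the variables consistent with `G`:
if `X` precedes `Y` then `Y` is not an ancestor of `X`. -/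
structure IsConsistentOrdering (prec : V → V → Prop) : Prop where
  isStrictTotalOrder : IsStrictTotalOrder V prec
  notMem_an : ∀ X Y, prec X Y → Y ∉ G.An {X}

end Graph

section Markov

variable {V : Type*}

/-- The variables that precede `X` in the ordering `prec`, together with `X`. -/
def upTo (prec : V → V → Prop) (X : V) : Set V := {Y | prec Y X ∨ Y = X}

variable (G : CausalGraph V)

/-- `C` is an ancestral c-component relative to `X`: the c-component of `X` in the induced subgraph
on some ancestral set that contains `X` and lies in `upTo prec X`. -/
def IsAncestralCComponent (prec : V → V → Prop) (X : V) (C : Set V) : Prop :=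
  ∃ S : Set V, G.IsAncestral S ∧ S ⊆ upTo prec X ∧ ∃ hX : X ∈ S, G.cComponentIn S X hX = C

/-- The set `S⁺` that belongs to the variable `X` and the ancestral c-component `C`. -/
def splus (prec : V → V → Prop) (X : V) (C : Set V) : Set V :=
  upTo prec X \ G.De (G.Spo C \ G.Pa C)

/-- The Markov blanket of `X` with respect to the induced subgraph on the ancestral set `A`:
the (proper) parents of the elements of the district `D` of `X` in that subgraph, and the elements
of `D` other than `X`. -/
def markovBlanket (A : Set V) (X : V) (hX : X ∈ A) : Set V :=
  {v | ∃ d ∈ G.cComponentIn A X hX, G.directed.Adj v d} ∪ (G.cComponentIn A X hX \ {X})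

variable [Finite V] {Ω : V → Type*} [∀ v, MeasurableSpace (Ω v)] [∀ v, StandardBorelSpace (Ω v)]

/-- The tuple of the variables in `A`: the projection of the joint state space to the coordinates
in `A`. -/
def tuple (Ω : V → Type*) (A : Set V) (ω : ∀ v, Ω v) : ∀ v : A, Ω v := fun v => ω v

theorem measurable_tuple {V : Type*} (Ω : V → Type*) [∀ v, MeasurableSpace (Ω v)] (A : Set V) :
    Measurable (tuple Ω A) :=
  measurable_pi_lambda _ fun v => measurable_pi_apply v.1

/-- Under the joint distribution `P` of the variables in `V` (the variable `v` takes values in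
`Ω v`), the variables in `A` and those in `B` are conditionally independent given those in `C`. -/
def CondIndepVars (P : Measure (∀ v, Ω v)) [IsFiniteMeasure P] (A B C : Set V) : Prop :=
  CondIndepFun (MeasurableSpace.comap (tuple Ω C) inferInstance)
    (measurable_tuple Ω C).comap_le (tuple Ω A) (tuple Ω B) P

/-- The c-component local Markov property (C-LMP) of `P` for `G` with respect to `prec`. -/
def CComponentLocalMarkov (prec : V → V → Prop) (P : Measure (∀ v, Ω v)) [IsFiniteMeasure P] :
    Prop :=
  ∀ (X : V) (C : Set V), G.IsAncestralCComponent prec X C →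
    CondIndepVars P {X} (G.splus prec X C \ G.Pa C) (G.Pa C \ {X})

/-- Richardson's ordered local Markov property of `P` for `G` with respect to `prec`: every `X` is
independent, given its Markov blanket with respect to `A`, of the other variables of `A`, for every
ancestral set `A` that contains `X` and lies in `upTo prec X`. -/
def OrderedLocalMarkov (prec : V → V → Prop) (P : Measure (∀ v, Ω v)) [IsFiniteMeasure P] :
    Prop :=
  ∀ (X : V) (A : Set V), G.IsAncestral A → A ⊆ upTo prec X → ∀ hX : X ∈ A,
    CondIndepVars P {X} (A \ (G.markovBlanket A X hX ∪ {X})) (G.markovBlanket A X hX)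

end Markov

end CausalGraph

namespace CausalGraph

section Graph

variable {V : Type*} {G : CausalGraph V}

/-! Below `X` in a consistent ordering, the Markov blanket of `X` in `A` is `Pa(C) \ {X}`, so it
depends on `A` only through the district `C` of `X`. Among the ancestral sets up to `X` with
district `C` there is a largest one, namely `S⁺`: it is ancestral, it contains all the others
(`subset_splus`), and it still has district `C` (`cComponentIn_splus`). Hence the C-LMP statement
for `C` is the ordered local statement for `A = S⁺`, and the ordered local statements for all other
`A` with district `C` follow from it by decomposition, the only axiom of conditional independence
needed. -/

theorem IsAncestral.mem_of_reflTransGen {S : Set V} (hS : G.IsAncestral S) {v w : V}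
    (hw : w ∈ S) (h : Relation.ReflTransGen G.directed.Adj v w) : v ∈ S := by
  rw [hS]
  exact ⟨w, hw, h⟩

theorem isAncestral_of_forall {S : Set V}
    (h : ∀ v w, w ∈ S → Relation.ReflTransGen G.directed.Adj v w → v ∈ S) :
    G.IsAncestral S :=
  Set.Subset.antisymm (fun v hv => ⟨v, hv, .refl⟩) fun v ⟨w, hw, hvw⟩ => h v w hw hvw

theorem cComponentIn_subset {S : Set V} {X : V} (hX : X ∈ S) : G.cComponentIn S X hX ⊆ S := by
  rintro _ ⟨v, -, rfl⟩
  exact v.2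

theorem self_mem_cComponentIn {S : Set V} {X : V} (hX : X ∈ S) :
    X ∈ G.cComponentIn S X hX :=
  ⟨⟨X, hX⟩, by simp [cComponent], rfl⟩

/-- A c-component is closed under bidirected edges within the set. -/
theorem mem_cComponentIn_of_adj {S : Set V} {X : V} (hX : X ∈ S) {v w : V}
    (hv : v ∈ G.cComponentIn S X hX) (hw : w ∈ S) (h : G.bidirected.Adj v w) :
    w ∈ G.cComponentIn S X hX := by
  obtain ⟨v, hv, rfl⟩ := hv
  refine ⟨⟨w, hw⟩, ?_, rfl⟩
  have hadj : (G.induce S).bidirected.Adj ⟨w, hw⟩ v := h.symm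
  simp only [cComponent, SimpleGraph.ConnectedComponent.mem_supp_iff] at hv ⊢
  rw [← hv, SimpleGraph.ConnectedComponent.eq]
  exact hadj.reachable

/-- A c-component is contained in every set that contains its base point and is closed under
bidirected edges from it within the ambient set. -/
theorem cComponentIn_subset_of_closed {S T : Set V} {X : V} (hX : X ∈ S) (hXT : X ∈ T)
    (hT : ∀ v w, v ∈ T → w ∈ S → G.bidirected.Adj v w → w ∈ T) :
    G.cComponentIn S X hX ⊆ T := by
  rintro _ ⟨w, hw, rfl⟩
  simp only [cComponent, SimpleGraph.ConnectedComponent.mem_supp_iff,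
    SimpleGraph.ConnectedComponent.eq] at hw
  obtain ⟨p⟩ := hw.symm
  -- Both endpoints are generalized so that membership in `T` can be propagated by induction along
  -- the walk.
  suffices H : ∀ {a b : S}, (G.induce S).bidirected.Walk a b → a.1 ∈ T → b.1 ∈ T from H p hXT
  intro a b q
  induction q with
  | nil => exact id
  | cons h _ ih => exact fun ha => ih (hT _ _ ha (Subtype.property _) h)

theorem Pa_cComponentIn_subset {S : Set V} (hS : G.IsAncestral S) {X : V} (hX : X ∈ S) :
    G.Pa (G.cComponentIn S X hX) ⊆ S := by
  rintro v (hv | ⟨a, ha, hva⟩)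
  · exact cComponentIn_subset hX hv
  · exact hS.mem_of_reflTransGen (cComponentIn_subset hX ha) (.single hva)

variable {prec : V → V → Prop}

theorem IsConsistentOrdering.isAncestral_upTo (hprec : G.IsConsistentOrdering prec) (X : V) :
    G.IsAncestral (upTo prec X) := by
  have := hprec.isStrictTotalOrder
  refine isAncestral_of_forall fun v w hw hvw => ?_
  rcases trichotomous_of prec v X with h | h | h
  · exact .inl h
  · exact .inr h
  · refine absurd ⟨w, rfl, hvw⟩ (hprec.notMem_an w v ?_)
    rcases hw with hw | rfl
    · exact trans_of prec hw h
    · exact h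

/-- `S⁺` is ancestral: it arises from an ancestral set by removing a set of descendants. -/
theorem IsConsistentOrdering.isAncestral_splus (hprec : G.IsConsistentOrdering prec) (X : V)
    (C : Set V) : G.IsAncestral (G.splus prec X C) :=
  isAncestral_of_forall fun _ _ hw hvw =>
    ⟨(hprec.isAncestral_upTo X).mem_of_reflTransGen hw.1 hvw,
      fun ⟨a, ha, hav⟩ => hw.2 ⟨a, ha, hav.trans hvw⟩⟩

/-- `S⁺` contains every ancestral set that gives rise to the c-component. -/
theorem subset_splus {S : Set V} (hS : G.IsAncestral S) {X : V} (hSX : S ⊆ upTo prec X)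
    (hX : X ∈ S) : S ⊆ G.splus prec X (G.cComponentIn S X hX) := by
  refine fun v hv => ⟨hSX hv, ?_⟩
  rintro ⟨w, ⟨⟨c, hc, hcw⟩, hw⟩, hwv⟩
  -- A removed spouse `w` with a descendant `v ∈ S` would lie in `S` by ancestrality, hence in the
  -- district itself, contradicting `w ∉ Pa(C)`.
  exact hw (.inl (mem_cComponentIn_of_adj hX hc (hS.mem_of_reflTransGen hv hwv) hcw.symm))

/-- The c-component of `X` does not grow when the ancestral set is enlarged to `S⁺`. -/
theorem cComponentIn_splus {S : Set V} (hS : G.IsAncestral S) {X : V} (hSX : S ⊆ upTo prec X)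
    (hX : X ∈ S) (hX' : X ∈ G.splus prec X (G.cComponentIn S X hX)) :
    G.cComponentIn (G.splus prec X (G.cComponentIn S X hX)) X hX' = G.cComponentIn S X hX := by
  apply Set.Subset.antisymm
  · refine cComponentIn_subset_of_closed hX' (self_mem_cComponentIn hX) fun v w hv hw h => ?_
    -- A spouse `w` of `C` that survives in `S⁺` must lie in `Pa(C)`, since all other spouses were
    -- removed. As `Pa(C) ⊆ S`, the edge to `w` lies inside `S`.
    refine mem_cComponentIn_of_adj hX hv (Pa_cComponentIn_subset hS hX ?_) h
    by_contra hPa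
    exact hw.2 ⟨w, ⟨⟨v, hv, h.symm⟩, hPa⟩, .refl⟩
  · exact cComponentIn_subset_of_closed hX (self_mem_cComponentIn hX') fun v w hv hw h =>
      mem_cComponentIn_of_adj hX' hv (subset_splus hS hSX hX hw) h

theorem IsConsistentOrdering.not_adj_of_mem_upTo (hprec : G.IsConsistentOrdering prec) {X Y : V}
    (hY : Y ∈ upTo prec X) : ¬ G.directed.Adj X Y := by
  intro h
  rcases hY with hY | rfl
  · exact hprec.notMem_an Y X hY ⟨Y, rfl, .single h⟩
  · exact G.acyclic Y (.single h)

/-- The blanket removes `X` only from the district, not from its parents. The two sides agree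
because `X`, being last in `A`, is a parent of no element of `A`. -/
theorem IsConsistentOrdering.markovBlanket_eq (hprec : G.IsConsistentOrdering prec) {A : Set V}
    {X : V} (hAX : A ⊆ upTo prec X) (hX : X ∈ A) :
    G.markovBlanket A X hX = G.Pa (G.cComponentIn A X hX) \ {X} := by
  ext v
  constructor
  · rintro (⟨d, hd, hvd⟩ | ⟨hv, hvX⟩)
    · refine ⟨.inr ⟨d, hd, hvd⟩, ?_⟩
      rintro rfl
      exact hprec.not_adj_of_mem_upTo (hAX (cComponentIn_subset hX hd)) hvd
    · exact ⟨.inl hv, hvX⟩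
  · rintro ⟨hv | hv, hvX⟩
    · exact .inr ⟨hv, hvX⟩
    · exact .inl hv

theorem IsConsistentOrdering.markovBlanket_union_singleton (hprec : G.IsConsistentOrdering prec)
    {A : Set V} {X : V} (hAX : A ⊆ upTo prec X) (hX : X ∈ A) :
    G.markovBlanket A X hX ∪ {X} = G.Pa (G.cComponentIn A X hX) := by
  rw [hprec.markovBlanket_eq hAX hX, Set.sdiff_union_self, Set.union_eq_left,
    Set.singleton_subset_iff]
  exact .inl (self_mem_cComponentIn hX)

end Graph

section Markov

variable {V : Type*} [Finite V] {Ω : V → Type*} [∀ v, MeasurableSpace (Ω v)]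
  [∀ v, StandardBorelSpace (Ω v)]

/-- The decomposition axiom of conditional independence. -/
theorem CondIndepVars.mono_right {P : Measure (∀ v, Ω v)} [IsFiniteMeasure P] {A B B' C : Set V}
    (h : CondIndepVars P A B C) (hB : B' ⊆ B) : CondIndepVars P A B' C :=
  CondIndepFun.comp h (φ := id) (ψ := fun (f : ∀ v : B, Ω v) (v : B') => f ⟨v, hB v.2⟩)
    measurable_id (measurable_pi_lambda _ fun _ => measurable_pi_apply _)

end Markov

end CausalGraph

open CausalGraph in
theorem mainTheorem2 {V : Type*} [Finite V] (G : CausalGraph V)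
    (prec : V → V → Prop) (hprec : G.IsConsistentOrdering prec)
    {Ω : V → Type*} [∀ v, MeasurableSpace (Ω v)] [∀ v, StandardBorelSpace (Ω v)]
    (P : Measure (∀ v, Ω v)) [IsProbabilityMeasure P] :
    G.OrderedLocalMarkov prec P ↔ G.CComponentLocalMarkov prec P := by
  constructor
  · rintro h X _ ⟨S, hS, hSX, hX, rfl⟩
    have hX' := subset_splus hS hSX hX hX
    have hle : G.splus prec X (G.cComponentIn S X hX) ⊆ upTo prec X := Set.sdiff_subset
    -- The ordered property is used at the maximal set `S⁺` rather than at `S`.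
    have key := h X _ (hprec.isAncestral_splus X _) hle hX'
    rwa [hprec.markovBlanket_union_singleton hle hX', hprec.markovBlanket_eq hle hX',
      cComponentIn_splus hS hSX hX hX'] at key
  · intro h X A hA hAX hX
    rw [hprec.markovBlanket_union_singleton hAX hX, hprec.markovBlanket_eq hAX hX]
    -- The set `A` is its own witness for the ancestral c-component, and `A ⊆ S⁺` lets decomposition
    -- shrink the independent set.
    exact (h X _ ⟨A, hA, hAX, hX, rfl⟩).mono_right
      (Set.sdiff_subset_sdiff_left (subset_splus hA hAX hX))
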